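/- A commutative FL-algebra is a structure $\langle A;\wedge,\vee,\cdot,\to,0,1\rangle$ such that $\langle A;\wedge,\vee\rangle$ is a lattice, $\langle A;\cdot,1\rangle$ is a commutative monoid, $0\in A$ is an arbitrary constant, and $a\cdot b\le c \iff a\le b\to c$ for all $a,b,c\in A$. Formulas are built from the variables $x_1,x_2,x_3,\dots$ in this language. Intuitionistic linear logic $\mathsf{ILL}$ is defined, for every set $\Gamma\cup\{\varphi\}$ of formulas, by: $\Gamma\vdash_{\mathsf{ILL}}\varphi$ iff there is a finite $\Sigma\subseteq\Gamma$ such that, in every commutative FL-algebra and under every assignment of the variables, if $\gamma\ge 1$ for all $\gamma\in\Sigma$, then $\varphi\ge 1$. A logic is a finitary, substitution invariant consequence relation on the set of formulas. A logic $\vdash$ is an axiomatic extension of $\mathsf{ILL}$ if there is a set $\mathrm{Ax}$ of formulas, closed under substitutions, such that $\Gamma\vdash\varphi\iff\Gamma\cup\mathrm{Ax}\vdash_{\mathsf{ILL}}\varphi$ for every set $\Gamma\cup\{\varphi\}$ of formulas. The theorems of $\vdash$ are the formulas $\varphi$ with $\emptyset\vdash\varphi$. A set of formulas is inconsistent in $\vdash$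 if it entails every formula. The logic $\vdash$ has the inconsistency lemma, witnessed by the sets $\sim_n$ ($n\in\mathbb{Z}^+$), if each $\sim_n\!(x_1,\dots,x_n)$ is a finite set of formulas whose variables are among $x_1,\dots,x_n$ and, for every $n \in \mathbb{Z}^+$, every finite set $\Gamma$ of formulas and all formulas $\varphi_1,\dots,\varphi_n$, $$\Gamma\cup\{\varphi_1,\dots,\varphi_n\}\text{ is inconsistent in }\vdash\iff\Gamma\vdash\chi(\varphi_1,\dots,\varphi_n)\text{ for every }\chi\in{\sim_n}\!(x_1,\dots,x_n).$$ For a formula $\varphi$, put $\varphi^1:=\varphi$ and $\varphi^{m+1}:=\varphi^m\cdot\varphi$ for $m \geq 1$. Furthermore, put $$\bot:=1\wedge(1\to0)\wedge(0\to1)\wedge(1\to(1\to1))\wedge((1\to1)\to1),\qquad \neg\varphi:=\varphi\to\bot .$$ **Proposition.** Let $\vdash$ be an axiomatic extension of $\mathsf{ILL}$ and let $x$ be a variable. Then $\vdash$ has the inconsistency lemma iff there exist $k\in\mathbb{Z}^+$ and a function $f\colon\mathbb{Z}^+\to\mathbb{Z}^+$ such that the formulas $$\bot^k\to x\qquad\text{and}\qquad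 (1\wedge\neg(x\wedge1)^m)^{f(m)}\to\neg(1\wedge x)^k,\quad\text{for every } m\in\mathbb{Z}^+,$$ are theorems of $\vdash$. Moreover, for every such $k$ and $f$, the inconsistency lemma for $\vdash$ is witnessed by the sets $${\sim_n}(x_1,\dots,x_n):=\{\neg(1\wedge x_1\wedge\dots\wedge x_n)^k\},\qquad n\in\mathbb{Z}^+.$$ Here $\neg\psi^j$ stands for $\neg(\psi^j)$. -/

import Mathlib

universe u v

/-- Formulas in the language `∧, ∨, ·, →, 0, 1` of commutative FL-algebras, with variables
from `α`. -/
inductive FLFormula (α : Type v) : Type v where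
  | var : α → FLFormula α
  | and : FLFormula α → FLFormula α → FLFormula α
  | or : FLFormula α → FLFormula α → FLFormula α
  | mul : FLFormula α → FLFormula α → FLFormula α
  | imp : FLFormula α → FLFormula α → FLFormula α
  | zero : FLFormula α
  | one : FLFormula α

/-- Commutative FL-algebras: a commutative monoid and a lattice on the same universe, a
residual `imp` of the multiplication, and an arbitrary constant `0`. The element `0` is only a
distinguished constant: no law is imposed on it. -/
class CommFLAlgebra (A : Type u) extends Lattice A, CommMonoid A, Zero A where
  imp : A → A → A
  mul_le_iff_le_imp : ∀ a b c : A, a * b ≤ c ↔ a ≤ imp b c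

namespace FLFormula

variable {α β : Type*}

/-- The homomorphic extension of the substitution `σ`. -/
def subst (σ : α → FLFormula β) : FLFormula α → FLFormula β
  | var x => σ x
  | and φ ψ => and (subst σ φ) (subst σ ψ)
  | or φ ψ => or (subst σ φ) (subst σ ψ)
  | mul φ ψ => mul (subst σ φ) (subst σ ψ)
  | imp φ ψ => imp (subst σ φ) (subst σ ψ)
  | zero => zero
  | one => one

/-- The value of a formula in a commutative FL-algebra under the assignment `e`. -/
def eval {A : Type u} [CommFLAlgebra A] (e : α → A) : FLFormula α → A
  | var x => e x
  | and φ ψ => eval e φ ⊓ eval e ψ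
  | or φ ψ => eval e φ ⊔ eval e ψ
  | mul φ ψ => eval e φ * eval e ψ
  | imp φ ψ => CommFLAlgebra.imp (eval e φ) (eval e ψ)
  | zero => 0
  | one => 1

theorem eval_subst {A : Type u} [CommFLAlgebra A] (e : β → A) (σ : α → FLFormula β)
    (φ : FLFormula α) : eval e (subst σ φ) = eval (fun x => eval e (σ x)) φ := by
  induction φ <;> simp_all [subst, eval]

/-- `φ.powSucc m` is `φ ^ (m + 1)`. -/
def powSucc (φ : FLFormula α) : ℕ → FLFormula α
  | 0 => φ
  | m + 1 => mul (powSucc φ m) φ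

/-- The power `φ ^ n`, for a positive integer `n`. -/
def pow (φ : FLFormula α) (n : ℕ+) : FLFormula α := powSucc φ n.natPred

theorem pow_one (φ : FLFormula α) : φ.pow 1 = φ := rfl

theorem pow_add_one (φ : FLFormula α) (n : ℕ+) : φ.pow (n + 1) = mul (φ.pow n) φ := by
  have h : (n + 1).natPred = n.natPred + 1 := by
    have h1 := PNat.natPred_add_one n
    have h2 := PNat.natPred_add_one (n + 1)
    have h3 := PNat.add_coe n 1
    have h4 := PNat.one_coe
    omega
  simp only [pow, h, powSucc]

/-- `⊥ := 1 ∧ (1 → 0) ∧ (0 → 1) ∧ (1 → (1 → 1)) ∧ ((1 → 1) → 1)`. -/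
def bot : FLFormula α :=
  ((((one.and (one.imp zero)).and (zero.imp one)).and (one.imp (one.imp one))).and
    ((one.imp one).imp one))

/-- `¬ φ := φ → ⊥`. -/
def neg (φ : FLFormula α) : FLFormula α := φ.imp bot

/-- The formula `1 ∧ φ₁ ∧ ⋯ ∧ φₙ`. -/
def oneAnd : (n : ℕ) → (Fin n → FLFormula α) → FLFormula α
  | 0, _ => one
  | n + 1, φ => (oneAnd n fun i => φ i.castSucc).and (φ (Fin.last n))

end FLFormula

/-- Formulas over the denumerable set of variables `xₙ`, with `n` a positive integer. -/
abbrev FLFm : Type := FLFormula ℕ+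

/-- Logics in the language of commutative FL-algebras: finitary, substitution invariant
consequence relations on the set of formulas. -/
structure FLLogic where
  Entails : Set FLFm → FLFm → Prop
  entails_of_mem : ∀ {Γ : Set FLFm} {φ : FLFm}, φ ∈ Γ → Entails Γ φ
  cut : ∀ {Γ Δ : Set FLFm} {φ : FLFm}, (∀ δ ∈ Δ, Entails Γ δ) → Entails Δ φ → Entails Γ φ
  substInvariant : ∀ {Γ : Set FLFm} {φ : FLFm} (σ : ℕ+ → FLFm), Entails Γ φ →
    Entails (FLFormula.subst σ '' Γ) (φ.subst σ)
  finitary : ∀ {Γ : Set FLFm} {φ : FLFm}, Entails Γ φ →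
    ∃ S : Set FLFm, S.Finite ∧ S ⊆ Γ ∧ Entails S φ

/-- The validity in all commutative FL-algebras of the implication from the conjunction of
the conditions `γ ≥ 1`, with `γ ∈ S`, to `φ ≥ 1`. -/
def FLeValid (S : Set FLFm) (φ : FLFm) : Prop :=
  ∀ (A : Type u) [CommFLAlgebra A] (e : ℕ+ → A),
    (∀ γ ∈ S, 1 ≤ FLFormula.eval e γ) → 1 ≤ FLFormula.eval e φ

/-- Intuitionistic linear logic. -/
def ILL : FLLogic where
  Entails Γ φ := ∃ S : Set FLFm, S.Finite ∧ S ⊆ Γ ∧ FLeValid.{u} S φ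
  entails_of_mem {Γ φ} h :=
    ⟨{φ}, Set.finite_singleton φ, Set.singleton_subset_iff.2 h, fun A _ e he => he φ rfl⟩
  cut {Γ Δ φ} h := by
    rintro ⟨S, hfin, hsub, hval⟩
    choose! T hTfin hTsub hTval using h
    refine ⟨⋃ δ ∈ S, T δ, hfin.biUnion fun δ hδ => hTfin δ (hsub hδ),
      Set.iUnion₂_subset fun δ hδ => hTsub δ (hsub hδ), fun A _ e he => ?_⟩
    refine hval A e fun δ hδ => hTval δ (hsub hδ) A e fun γ hγ => he γ ?_
    exact Set.mem_biUnion hδ hγ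
  substInvariant {Γ φ} σ := by
    rintro ⟨S, hfin, hsub, hval⟩
    refine ⟨FLFormula.subst σ '' S, hfin.image _, Set.image_mono hsub, fun A _ e he => ?_⟩
    rw [FLFormula.eval_subst]
    refine hval A _ fun γ hγ => ?_
    rw [← FLFormula.eval_subst]
    exact he _ (Set.mem_image_of_mem _ hγ)
  finitary {Γ φ} := by
    rintro ⟨S, hfin, hsub, hval⟩
    exact ⟨S, hfin, hsub, S, hfin, subset_rfl, hval⟩

namespace FLLogic

/-- `L` is an axiomatic extension of `L₀`: it is obtained from `L₀` by adding, as axioms, a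
set of formulas closed under substitutions. -/
def IsAxiomaticExtension (L L₀ : FLLogic) : Prop :=
  ∃ Ax : Set FLFm, (∀ α ∈ Ax, ∀ σ : ℕ+ → FLFm, α.subst σ ∈ Ax) ∧
    ∀ (Γ : Set FLFm) (φ : FLFm), L.Entails Γ φ ↔ L₀.Entails (Γ ∪ Ax) φ

/-- `φ` is a theorem of `L`. -/
def IsTheorem (L : FLLogic) (φ : FLFm) : Prop := L.Entails ∅ φ

/-- A set of formulas is inconsistent in `L` when it entails every formula. -/
def Inconsistent (L : FLLogic) (Γ : Set FLFm) : Prop := ∀ φ : FLFm, L.Entails Γ φ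

/-- The sets `N n` of formulas in the variables `x₁, …, xₙ` (indexed here by `Fin n`), with
`n` a positive integer, witness the inconsistency lemma for `L`. -/
def WitnessesIL (L : FLLogic) (N : (n : ℕ+) → Set (FLFormula (Fin n))) : Prop :=
  ∀ (n : ℕ+), (N n).Finite ∧
    ∀ (Γ : Set FLFm), Γ.Finite → ∀ φ : Fin n → FLFm,
      L.Inconsistent (Γ ∪ Set.range φ) ↔ ∀ χ ∈ N n, L.Entails Γ (χ.subst φ)

/-- `L` has the inconsistency lemma. -/
def HasIL (L : FLLogic) : Prop :=
  ∃ N : (n : ℕ+) → Set (FLFormula (Fin n)), L.WitnessesIL N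

end FLLogic

namespace CommFLAlgebra

variable {A : Type u} [CommFLAlgebra A]

/-! The engine is the local deduction theorem: `Γ, φ ⊢ ψ` yields `Γ ⊢ (φ ∧ 1)^m → ψ` for some `m`.
If every `m` had a countermodel, the product of these, modulo the filter generated by the value of
`φ`, would refute `Γ, φ ⊢ ψ`.

Given the inconsistency lemma with `N = ∼₁`, the set `N(φ) ∪ {φ}` is inconsistent. For `φ = 1`, the
formulas of `N(1)` follow from `⊥`, so `⊥` entails everything, and deduction gives `⊥^k → x`. For `φ
= x`, deduction gives `N(x) ⊢ ¬(x ∧ 1)^k`. As `x` is inconsistent with `¬(x ∧ 1)^m`, the latter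
entails `N(x)`, hence `¬(x ∧ 1)^k`; deduction then supplies `f m`.

Conversely, an inconsistency gives `Γ ⊢ ¬ψ^m` with `ψ = 1 ∧ φ₁ ∧ ⋯ ∧ φₙ`, and the second family of
theorems trades the variable `m` for the fixed `k`. -/

instance : IsOrderedMonoid A where
  mul_le_mul_left a b hab c := by
    rw [mul_le_iff_le_imp]
    exact hab.trans ((mul_le_iff_le_imp _ _ _).1 le_rfl)

theorem one_le_imp_iff {a b : A} : 1 ≤ imp a b ↔ a ≤ b := by
  rw [← mul_le_iff_le_imp, one_mul]

theorem one_imp (a : A) : imp 1 a = a := by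
  apply le_antisymm
  · simpa using (mul_le_iff_le_imp (imp 1 a) 1 a).2 le_rfl
  · simpa using (mul_le_iff_le_imp a 1 a).1 (mul_one a).le

theorem imp_mono {a b c d : A} (hab : b ≤ a) (hcd : c ≤ d) : imp a c ≤ imp b d := by
  rw [← mul_le_iff_le_imp]
  exact (mul_le_mul_right hab _).trans (((mul_le_iff_le_imp _ _ _).2 le_rfl).trans hcd)

/-- The preorder induced by `≤` modulo the filter generated by `a`. -/
def PowLE (a x y : A) : Prop := ∃ n : ℕ, (a ⊓ 1) ^ n * x ≤ y

namespace PowLE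

variable {a x y z w : A}

theorem of_le (h : x ≤ y) : PowLE a x y := ⟨0, by simpa using h⟩

theorem trans (hxy : PowLE a x y) (hyz : PowLE a y z) : PowLE a x z := by
  obtain ⟨m, hm⟩ := hxy
  obtain ⟨n, hn⟩ := hyz
  refine ⟨n + m, ?_⟩
  rw [pow_add, mul_assoc]
  exact (mul_le_mul_right hm _).trans hn

/-- Powers of `a ⊓ 1` decrease, so two witnesses can be raised to a common exponent. -/
theorem exists_of_le {n m : ℕ} (hnm : n ≤ m) (h : (a ⊓ 1) ^ n * x ≤ y) :
    (a ⊓ 1) ^ m * x ≤ y :=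
  (mul_le_mul_left (pow_le_pow_right_of_le_one' inf_le_right hnm) x).trans h

theorem inf (hxy : PowLE a x y) (hxz : PowLE a x z) : PowLE a x (y ⊓ z) := by
  obtain ⟨m, hm⟩ := hxy
  obtain ⟨n, hn⟩ := hxz
  exact ⟨max m n, le_inf (exists_of_le (le_max_left m n) hm) (exists_of_le (le_max_right m n) hn)⟩

theorem sup (hxz : PowLE a x z) (hyz : PowLE a y z) : PowLE a (x ⊔ y) z := by
  obtain ⟨m, hm⟩ := hxz
  obtain ⟨n, hn⟩ := hyz
  refine ⟨max m n, ?_⟩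
  rw [mul_comm, mul_le_iff_le_imp]
  refine sup_le ?_ ?_ <;> rw [← mul_le_iff_le_imp, mul_comm]
  · exact exists_of_le (le_max_left m n) hm
  · exact exists_of_le (le_max_right m n) hn

theorem mul (hxy : PowLE a x y) (hzw : PowLE a z w) : PowLE a (x * z) (y * w) := by
  obtain ⟨m, hm⟩ := hxy
  obtain ⟨n, hn⟩ := hzw
  refine ⟨m + n, ?_⟩
  rw [pow_add, mul_mul_mul_comm]
  exact mul_le_mul' hm hn

theorem mul_iff_imp : PowLE a (x * y) z ↔ PowLE a x (CommFLAlgebra.imp y z) := by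
  simp only [PowLE, ← mul_assoc, mul_le_iff_le_imp]

theorem imp (hyx : PowLE a y x) (hzw : PowLE a z w) :
    PowLE a (CommFLAlgebra.imp x z) (CommFLAlgebra.imp y w) := by
  rw [← mul_iff_imp]
  exact ((of_le le_rfl).mul hyx).trans ((mul_iff_imp.2 (of_le le_rfl)).trans hzw)

end PowLE

/-- The congruence determined by the filter generated by `a`. -/
def powSetoid (a : A) : Setoid A where
  r x y := PowLE a x y ∧ PowLE a y x
  iseqv :=
    ⟨fun _ => ⟨.of_le le_rfl, .of_le le_rfl⟩, And.symm,
      fun h h' => ⟨h.1.trans h'.1, h'.2.trans h.2⟩⟩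

/-- The quotient of `A` by the filter generated by `a`. -/
def PowQuotient (a : A) : Type u := Quotient (powSetoid a)

namespace PowQuotient

/-- The quotient map. -/
def mk (a : A) (x : A) : PowQuotient a := Quotient.mk (powSetoid a) x

variable {a : A}

instance : CommFLAlgebra (PowQuotient a) where
  le := Quotient.lift₂ (PowLE a) fun _ _ _ _ h h' =>
    propext ⟨fun k => (h.2.trans k).trans h'.1, fun k => (h.1.trans k).trans h'.2⟩
  le_refl := by
    rintro ⟨x⟩
    exact .of_le le_rfl
  le_trans := by
    rintro ⟨x⟩ ⟨y⟩ ⟨z⟩ h h'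
    exact PowLE.trans h h'
  le_antisymm := by
    rintro ⟨x⟩ ⟨y⟩ h h'
    exact Quotient.sound ⟨h, h'⟩
  inf := Quotient.map₂ (· ⊓ ·) fun _ _ h _ _ h' =>
    ⟨.inf ((PowLE.of_le inf_le_left).trans h.1) ((PowLE.of_le inf_le_right).trans h'.1),
      .inf ((PowLE.of_le inf_le_left).trans h.2) ((PowLE.of_le inf_le_right).trans h'.2)⟩
  sup := Quotient.map₂ (· ⊔ ·) fun _ _ h _ _ h' =>
    ⟨.sup (h.1.trans (.of_le le_sup_left)) (h'.1.trans (.of_le le_sup_right)),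
      .sup (h.2.trans (.of_le le_sup_left)) (h'.2.trans (.of_le le_sup_right))⟩
  mul := Quotient.map₂ (· * ·) fun _ _ h _ _ h' => ⟨h.1.mul h'.1, h.2.mul h'.2⟩
  imp := Quotient.map₂ imp fun _ _ h _ _ h' => ⟨h.2.imp h'.1, h.1.imp h'.2⟩
  one := mk a 1
  zero := mk a 0
  inf_le_left := by
    rintro ⟨x⟩ ⟨y⟩
    exact .of_le inf_le_left
  inf_le_right := by
    rintro ⟨x⟩ ⟨y⟩
    exact .of_le inf_le_right
  le_inf := by
    rintro ⟨x⟩ ⟨y⟩ ⟨z⟩ h h'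
    exact PowLE.inf h h'
  le_sup_left := by
    rintro ⟨x⟩ ⟨y⟩
    exact .of_le le_sup_left
  le_sup_right := by
    rintro ⟨x⟩ ⟨y⟩
    exact .of_le le_sup_right
  sup_le := by
    rintro ⟨x⟩ ⟨y⟩ ⟨z⟩ h h'
    exact PowLE.sup h h'
  mul_assoc := by
    rintro ⟨x⟩ ⟨y⟩ ⟨z⟩
    exact congrArg (mk a) (mul_assoc x y z)
  mul_comm := by
    rintro ⟨x⟩ ⟨y⟩
    exact congrArg (mk a) (mul_comm x y)
  one_mul := by
    rintro ⟨x⟩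
    exact congrArg (mk a) (one_mul x)
  mul_one := by
    rintro ⟨x⟩
    exact congrArg (mk a) (mul_one x)
  mul_le_iff_le_imp := by
    rintro ⟨x⟩ ⟨y⟩ ⟨z⟩
    exact PowLE.mul_iff_imp

theorem one_le_mk_iff {x : A} : 1 ≤ mk a x ↔ ∃ n : ℕ, (a ⊓ 1) ^ n ≤ x := by
  change PowLE a 1 x ↔ _
  simp only [PowLE, mul_one]

theorem eval_mk {α : Type*} (e : α → A) (φ : FLFormula α) :
    φ.eval (fun i => mk a (e i)) = mk a (φ.eval e) := by
  induction φ with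
  | var => rfl
  | zero => rfl
  | one => rfl
  | and φ ψ hφ hψ => simp only [FLFormula.eval, hφ, hψ]; rfl
  | or φ ψ hφ hψ => simp only [FLFormula.eval, hφ, hψ]; rfl
  | mul φ ψ hφ hψ => simp only [FLFormula.eval, hφ, hψ]; rfl
  | imp φ ψ hφ hψ => simp only [FLFormula.eval, hφ, hψ]; rfl

end PowQuotient

instance {ι : Type v} {B : ι → Type u} [∀ i, CommFLAlgebra (B i)] :
    CommFLAlgebra (∀ i, B i) where
  imp x y i := imp (x i) (y i)
  mul_le_iff_le_imp x y z := forall_congr' fun i => mul_le_iff_le_imp (x i) (y i) (z i)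

theorem eval_pi {ι : Type v} {B : ι → Type u} [∀ i, CommFLAlgebra (B i)] {α : Type*}
    (e : α → ∀ i, B i) (φ : FLFormula α) (i : ι) :
    φ.eval e i = φ.eval fun x => e x i := by
  induction φ with
  | var => rfl
  | zero => rfl
  | one => rfl
  | and φ ψ hφ hψ => simp only [FLFormula.eval, ← hφ, ← hψ]; rfl
  | or φ ψ hφ hψ => simp only [FLFormula.eval, ← hφ, ← hψ]; rfl
  | mul φ ψ hφ hψ => simp only [FLFormula.eval, ← hφ, ← hψ]; rfl
  | imp φ ψ hφ hψ => simp only [FLFormula.eval, ← hφ, ← hψ]; rfl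

end CommFLAlgebra

/-! ### Evaluation and substitution of the special formulas -/

namespace FLFormula

open CommFLAlgebra

variable {α β : Type*} {A : Type u} [CommFLAlgebra A] (e : α → A)

theorem eval_pow (φ : FLFormula α) (m : ℕ+) : (φ.pow m).eval e = φ.eval e ^ (m : ℕ) := by
  induction m using PNat.recOn with
  | one => simp [pow_one]
  | succ m ih => rw [pow_add_one, eval, ih, PNat.add_coe, PNat.one_coe, pow_succ]

/-- `1 → a` equals `a`, so the last two conjuncts of `⊥` have value `1` and are absorbed. -/
theorem eval_bot : (bot : FLFormula α).eval e = 1 ⊓ 0 ⊓ CommFLAlgebra.imp 0 1 := by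
  have h : (1 : A) ⊓ 0 ⊓ CommFLAlgebra.imp 0 1 ≤ 1 := inf_le_left.trans inf_le_left
  simp only [bot, eval, one_imp, inf_of_le_left h]

theorem eval_bot_le_one : (bot : FLFormula α).eval e ≤ 1 := by
  rw [eval_bot]
  exact inf_le_left.trans inf_le_left

theorem one_le_eval_oneAnd_iff {n : ℕ} (φ : Fin n → FLFormula α) :
    1 ≤ (oneAnd n φ).eval e ↔ ∀ i, 1 ≤ (φ i).eval e := by
  induction n with
  | zero => simp [oneAnd, eval]
  | succ n ih => simp [oneAnd, eval, ih, Fin.forall_fin_succ']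

theorem eval_oneAnd_le_one {n : ℕ} (φ : Fin n → FLFormula α) : (oneAnd n φ).eval e ≤ 1 := by
  induction n with
  | zero => exact le_rfl
  | succ n ih => exact inf_le_left.trans (ih _)

theorem subst_powSucc (σ : α → FLFormula β) (φ : FLFormula α) (m : ℕ) :
    (φ.powSucc m).subst σ = (φ.subst σ).powSucc m := by
  induction m with
  | zero => rfl
  | succ m ih => simp only [powSucc, subst, ih]

theorem subst_oneAnd (σ : α → FLFormula β) {n : ℕ} (φ : Fin n → FLFormula α) :
    (oneAnd n φ).subst σ = oneAnd n fun i => (φ i).subst σ := by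
  induction n with
  | zero => rfl
  | succ n ih => simp only [oneAnd, subst, ih]

theorem subst_neg_pow_oneAnd_var {n : ℕ} (φ : Fin n → FLFormula α) (k : ℕ+) :
    (((oneAnd n var).pow k).neg).subst φ = ((oneAnd n φ).pow k).neg := by
  simp only [neg, pow, subst, subst_powSucc, subst_oneAnd]
  rfl

/-- `⊥ ≥ 1` forces `0 = 1`, and then `{1}` is closed under all operations. -/
theorem eval_subst_one (h : 1 ≤ (bot : FLFormula α).eval e) (φ : FLFormula β) :
    (φ.subst fun _ => (one : FLFormula α)).eval e = 1 := by
  rw [eval_bot, le_inf_iff, le_inf_iff, one_le_imp_iff] at h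
  have h0 : (0 : A) = 1 := le_antisymm h.2 h.1.2
  induction φ <;> simp_all [subst, eval, one_imp]

end FLFormula

open FLFormula CommFLAlgebra

/-- The local deduction theorem for the validity relation of commutative FL-algebras. -/
theorem FLeValid.exists_imp {S : Set FLFm} {φ ψ : FLFm} (h : FLeValid.{u} (insert φ S) ψ) :
    ∃ m : ℕ+, FLeValid.{u} S (((φ.and one).pow m).imp ψ) := by
  by_contra! hne
  simp only [FLeValid, not_forall, exists_prop] at hne
  choose B inst e hS hψ using hne
  -- In the product, one exponent must serve all coordinates at once, including the one built to
  -- refute it.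
  let d : ℕ+ → ∀ m, B m := fun x m => e m x
  have hd (χ : FLFm) (m : ℕ+) : χ.eval d m = χ.eval (e m) := eval_pi d χ m
  have hq := h (PowQuotient (φ.eval d)) (fun x => PowQuotient.mk _ (d x)) ?_
  · rw [PowQuotient.eval_mk, PowQuotient.one_le_mk_iff] at hq
    obtain ⟨n, hn⟩ := hq
    -- The filter exponent `n` may be `0`, but countermodels are indexed by positive exponents.
    have hle : (φ.eval d ⊓ 1) ^ (n + 1) ≤ ψ.eval d :=
      (pow_le_pow_right_of_le_one' inf_le_right n.le_succ).trans hn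
    refine hψ n.succPNat ?_
    rw [eval, one_le_imp_iff, eval_pow, ← hd ψ]
    have := hle n.succPNat
    rw [Pi.pow_apply, Pi.inf_apply, hd φ] at this
    exact this
  · rintro γ (rfl | hγ) <;> rw [PowQuotient.eval_mk, PowQuotient.one_le_mk_iff]
    · exact ⟨1, by simp⟩
    · refine ⟨0, fun m => ?_⟩
      rw [hd γ, pow_zero]
      exact hS m γ hγ

/-! ### Axiomatic extensions and the inconsistency lemma -/

namespace FLLogic

variable {L : FLLogic}

theorem Entails.mono {Γ Δ : Set FLFm} {φ : FLFm} (h : L.Entails Γ φ) (hsub : Γ ⊆ Δ) :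
    L.Entails Δ φ :=
  L.cut (fun _ hγ => L.entails_of_mem (hsub hγ)) h

theorem exists_inconsistent_insert_iff (hN : L.HasIL) : ∃ N : Set (FLFormula (Fin 1)), N.Finite ∧
    ∀ Γ : Set FLFm, Γ.Finite → ∀ φ : FLFm,
      (L.Inconsistent (insert φ Γ) ↔ ∀ χ ∈ N, L.Entails Γ (χ.subst fun _ => φ)) := by
  obtain ⟨N, hN⟩ := hN
  refine ⟨N 1, (hN 1).1, fun Γ hΓ φ => ?_⟩
  have hrange : Γ ∪ Set.range (fun _ : Fin 1 => φ) = insert φ Γ := by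
    rw [Set.range_const, Set.union_singleton]
  rw [← hrange]
  exact (hN 1).2 Γ hΓ fun _ => φ

namespace IsAxiomaticExtension

theorem entails_of_valid (hL : L.IsAxiomaticExtension ILL.{u}) {Γ S : Set FLFm} {φ : FLFm}
    (hS : S.Finite) (h : ∀ δ ∈ S, L.Entails Γ δ) (hv : FLeValid.{u} S φ) : L.Entails Γ φ := by
  obtain ⟨Ax, -, hAx⟩ := hL
  exact L.cut h ((hAx S φ).2 ⟨S, hS, Set.subset_union_left, hv⟩)

theorem entails_of_entails (hL : L.IsAxiomaticExtension ILL.{u}) {Γ : Set FLFm} {δ φ : FLFm}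
    (h : L.Entails Γ δ)
    (hv : ∀ (A : Type u) [CommFLAlgebra A] (e : ℕ+ → A), 1 ≤ δ.eval e → 1 ≤ φ.eval e) :
    L.Entails Γ φ :=
  hL.entails_of_valid (Set.finite_singleton δ) (by simpa using h)
    fun A _ e he => hv A e (he δ rfl)

theorem entails_of_entails₂ (hL : L.IsAxiomaticExtension ILL.{u}) {Γ : Set FLFm}
    {δ₁ δ₂ φ : FLFm} (h₁ : L.Entails Γ δ₁) (h₂ : L.Entails Γ δ₂)
    (hv : ∀ (A : Type u) [CommFLAlgebra A] (e : ℕ+ → A),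
      1 ≤ δ₁.eval e → 1 ≤ δ₂.eval e → 1 ≤ φ.eval e) : L.Entails Γ φ :=
  hL.entails_of_valid (Set.toFinite {δ₁, δ₂}) (by simp [h₁, h₂])
    fun A _ e he => hv A e (he δ₁ (by simp)) (he δ₂ (by simp))

/-- The local deduction theorem for axiomatic extensions of `ILL`. -/
theorem exists_entails_imp (hL : L.IsAxiomaticExtension ILL.{u}) {Γ : Set FLFm} {φ ψ : FLFm}
    (h : L.Entails (insert φ Γ) ψ) : ∃ m : ℕ+, L.Entails Γ (((φ.and one).pow m).imp ψ) := by
  obtain ⟨Ax, -, hAx⟩ := hL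
  obtain ⟨S, hfin, hsub, hval⟩ := (hAx _ _).1 h
  obtain ⟨m, hm⟩ := FLeValid.exists_imp (S := S \ {φ}) (φ := φ) (ψ := ψ)
    fun A _ e he => hval A e fun γ hγ => he γ (by
      by_cases hγφ : γ = φ
      · exact Or.inl hγφ
      · exact Or.inr ⟨hγ, hγφ⟩)
  refine ⟨m, (hAx _ _).2 ⟨S \ {φ}, hfin.sdiff, ?_, hm⟩⟩
  rintro γ ⟨hγ, hγφ⟩
  rcases hsub hγ with (hγ | hγ) | hγ
  · exact absurd hγ hγφ
  · exact Or.inl hγ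
  · exact Or.inr hγ

theorem entails_of_entails_bot (hL : L.IsAxiomaticExtension ILL.{u}) {k i : ℕ+}
    (hk : L.IsTheorem ((bot.pow k).imp (var i))) {Γ : Set FLFm} (h : L.Entails Γ bot) (φ : FLFm) :
    L.Entails Γ φ := by
  have hs := (L.substInvariant (fun _ => φ) hk).mono (Δ := Γ) (by simp)
  refine hL.entails_of_entails₂ h hs fun A _ e hb hφ => ?_
  rw [eval_subst, eval, one_le_imp_iff, eval_pow, eval_bot] at hφ
  rw [eval_bot] at hb
  exact (one_le_pow_of_one_le' hb _).trans hφ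

theorem witnessesIL (hL : L.IsAxiomaticExtension ILL.{u}) {k i : ℕ+} {f : ℕ+ → ℕ+}
    (hk : L.IsTheorem ((bot.pow k).imp (var i)))
    (hf : ∀ m : ℕ+, L.IsTheorem (((one.and (((var i).and one).pow m).neg).pow (f m)).imp
      ((one.and (var i)).pow k).neg)) :
    L.WitnessesIL fun n => {((oneAnd n var).pow k).neg} := by
  refine fun n => ⟨Set.finite_singleton _, fun Γ _ φ => ?_⟩
  simp only [Set.mem_singleton_iff, forall_eq, subst_neg_pow_oneAnd_var]
  constructor
  · intro hinc
    -- Merging the `φⱼ` into one conjunction allows a single use of deduction.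
    have hbot : L.Entails (insert (oneAnd n φ) Γ) bot := by
      refine L.cut (Δ := Γ ∪ Set.range φ) ?_ (hinc bot)
      rintro _ (hγ | ⟨j, rfl⟩)
      · exact L.entails_of_mem (Or.inr hγ)
      · exact hL.entails_of_entails (L.entails_of_mem (Or.inl rfl))
          fun A _ e he => (one_le_eval_oneAnd_iff e φ).1 he j
    obtain ⟨m, hm⟩ := hL.exists_entails_imp hbot
    have hs := (L.substInvariant (fun _ => oneAnd n φ) (hf m)).mono (Δ := Γ) (by simp)
    refine hL.entails_of_entails₂ hm hs fun A _ e hm hs => ?_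
    simp only [eval_subst, eval, neg, eval_pow, one_le_imp_iff] at hm hs ⊢
    rw [inf_of_le_right (eval_oneAnd_le_one e φ)] at hs
    rw [← one_le_imp_iff]
    refine le_trans (one_le_pow_of_one_le' (le_inf le_rfl ?_) _) hs
    rw [one_le_imp_iff]
    simpa only [eval_bot] using hm
  · intro h
    refine hL.entails_of_entails_bot hk ?_
    refine hL.entails_of_valid (S := insert ((oneAnd n φ).pow k).neg (Set.range φ))
      ((Set.finite_range φ).insert _) ?_ fun A _ e he => ?_
    · rintro _ (rfl | hφ)
      · exact h.mono Set.subset_union_left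
      · exact L.entails_of_mem (Or.inr hφ)
    · have h1 := he _ (Or.inl rfl)
      rw [neg, eval, one_le_imp_iff, eval_pow] at h1
      refine (one_le_pow_of_one_le' ?_ _).trans h1
      exact (one_le_eval_oneAnd_iff e φ).2 fun j => he _ (Or.inr ⟨j, rfl⟩)

theorem exists_isTheorem (hL : L.IsAxiomaticExtension ILL.{u}) (hIL : L.HasIL) (i : ℕ+) :
    ∃ (k : ℕ+) (f : ℕ+ → ℕ+), L.IsTheorem ((bot.pow k).imp (var i)) ∧
      ∀ m : ℕ+, L.IsTheorem (((one.and (((var i).and one).pow m).neg).pow (f m)).imp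
        ((one.and (var i)).pow k).neg) := by
  obtain ⟨N, hfin, hN⟩ := exists_inconsistent_insert_iff hIL
  have hinc (φ : FLFm) :
      L.Inconsistent (insert φ ((fun χ => subst (fun _ => φ) χ) '' N)) :=
    -- The set `N(φ)` itself serves as `Γ`, which is allowed because `N` is finite.
    (hN _ (hfin.image _) φ).2 fun χ hχ => L.entails_of_mem (Set.mem_image_of_mem _ hχ)
  have hbot (φ : FLFm) : L.Entails {bot} φ := by
    refine L.cut ?_ (hinc one φ)
    rintro _ (rfl | ⟨χ, -, rfl⟩) <;>
      refine hL.entails_of_entails (L.entails_of_mem rfl) fun A _ e he => ?_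
    · exact le_rfl
    · exact (eval_subst_one e he χ).ge
  obtain ⟨k₁, hk₁⟩ := hL.exists_entails_imp (Γ := ∅) (φ := bot) (ψ := var i)
    ((hbot _).mono (by simp))
  obtain ⟨k₂, hk₂⟩ := hL.exists_entails_imp (hinc (var i) bot)
  have hex (m : ℕ+) : ∃ l : ℕ+, L.Entails ∅ (((((var i).and one).pow m).neg.and one).pow l |>.imp
      (((var i).and one).pow k₂).neg) := by
    refine hL.exists_entails_imp (L.cut ?_ hk₂)
    rintro _ ⟨χ, hχ, rfl⟩
    -- Adding `x` to `¬(x ∧ 1)^m` yields `⊥`, hence inconsistency, hence every formula of `N(x)`.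
    refine (hN _ (Set.toFinite _) (var i)).1 (fun φ => L.cut ?_ (hbot φ)) χ hχ
    rintro _ rfl
    refine hL.entails_of_entails₂ (L.entails_of_mem (Or.inl rfl))
      (L.entails_of_mem (Or.inr (Or.inl rfl))) fun A _ e hx hm => ?_
    rw [neg, eval, one_le_imp_iff, eval_pow] at hm
    exact (one_le_pow_of_one_le' (le_inf hx le_rfl) _).trans hm
  choose f hf using hex
  -- Both theorems survive raising `k`: the powers of `⊥` and of `1 ∧ x` decrease, and negation is
  -- antitone.
  refine ⟨max k₁ k₂, f, hL.entails_of_entails hk₁ fun A _ e h => ?_, fun m =>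
    hL.entails_of_entails (hf m) fun A _ e h => ?_⟩
  · rw [eval, one_le_imp_iff, eval_pow] at h ⊢
    rw [eval, eval, eval, inf_of_le_left (eval_bot_le_one e)] at h
    exact (pow_le_pow_right_of_le_one' (eval_bot_le_one e) (le_max_left k₁ k₂)).trans h
  · simp only [neg, eval, one_le_imp_iff, eval_pow] at h ⊢
    rw [inf_comm, inf_comm 1 (e i)]
    exact h.trans (imp_mono
      (pow_le_pow_right_of_le_one' inf_le_right (le_max_right k₁ k₂)) le_rfl)

end IsAxiomaticExtension

end FLLogic

theorem mainTheorem10 (L : FLLogic) (hL : L.IsAxiomaticExtension ILL.{u}) (i : ℕ+) (x : FLFm)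
    (hx : x = FLFormula.var i) :
    (L.HasIL ↔
      ∃ (k : ℕ+) (f : ℕ+ → ℕ+),
        L.IsTheorem ((FLFormula.bot.pow k).imp x) ∧
        ∀ m : ℕ+, L.IsTheorem
          (((FLFormula.one.and ((x.and FLFormula.one).pow m).neg).pow (f m)).imp
            ((FLFormula.one.and x).pow k).neg)) ∧
    (∀ (k : ℕ+) (f : ℕ+ → ℕ+),
      (L.IsTheorem ((FLFormula.bot.pow k).imp x) ∧
        ∀ m : ℕ+, L.IsTheorem
          (((FLFormula.one.and ((x.and FLFormula.one).pow m).neg).pow (f m)).imp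
            ((FLFormula.one.and x).pow k).neg)) →
      L.WitnessesIL fun n => {((FLFormula.oneAnd n FLFormula.var).pow k).neg}) := by

  subst hx
  have hW (k : ℕ+) (f : ℕ+ → ℕ+) (h : _ ∧ _) := hL.witnessesIL (k := k) (i := i) (f := f) h.1 h.2
  exact ⟨⟨fun h => hL.exists_isTheorem h i, fun ⟨k, f, h⟩ => ⟨_, hW k f h⟩⟩, hW⟩
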